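/- Let $n\ge 0$ and let $X$ and $Y$ be reduced real analytic $n$-orbifolds, i.e. paracompact Hausdorff spaces equipped with a maximal real analytic orbifold atlas. The atlas consists of charts $(\tilde U,G,\varphi)$, where $\tilde U\subseteq\mathbb R^n$ is connected, nonempty and open, $G$ is a finite group acting effectively and real analytically on $\tilde U$, and $\varphi$ is a $G$-invariant map on $\tilde U$ which induces a homeomorphism of $\tilde U/G$ onto an open subset $U$ of the space. The charts cover the space, and around every common point of two charts there is a chart of the atlas that embeds into both. Here an embedding $\lambda\colon(\tilde U,G,\varphi)\to(\tilde V,H,\psi)$ is a real analytic embedding $\tilde U\to\tilde V$ with $\psi\circ\lambda=\varphi$ that is equivariant along an injective homomorphism $G\to H$. The frame bundle $\mathrm{Fr}(X)$ is the colimit of the real analytic manifolds $\mathrm{Fr}(\tilde U)/G$ along the maps induced by all embeddings of charts of the maximal atlas, where $\mathrm{Fr}(\tilde U)=\tilde U\times \mathrm{GL}_n(\mathbb R)$, $g\in G$ acts by $g(x,B)=(gx,(dg)_x\circ B)$, and $\lambda$ induces $(x,B)\mapsto(\lambda(x),(d\lambda)_x\circ B)$. It is a real analytic manifold with the right action $[x,B]\cdot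 A=[x,B\circ A]$ of $\mathrm{GL}_n(\mathbb R)$ and the projection $p_X\colon \mathrm{Fr}(X)\to X$, $[x,B]\mapsto\varphi(x)$. Let $2\le r\le\omega$ (where $\mathrm C^\infty$ means smooth, $\mathrm C^\omega$ means real analytic, $\infty-1=\infty$ and $\omega-1=\omega$), and let $f\colon X\to Y$ be a $\mathrm C^r$-diffeomorphism of orbifolds, i.e. a bijection such that each of $f$ and $f^{-1}$ has, around every point, a lift to charts that is of class $\mathrm C^r$ and equivariant along a homomorphism of the chart groups. Then $f$ induces a $\mathrm C^{r-1}$-diffeomorphism $\hat f\colon \mathrm{Fr}(X)\to \mathrm{Fr}(Y)$ that is $\mathrm{GL}_n(\mathbb R)$-equivariant and satisfies $p_Y\circ\hat f=f\circ p_X$. That $f$ induces $\hat f$ means that $\hat f$ is the unique map such that, for all charts $(\tilde U,G,\varphi)$ of $X$ and $(\tilde V,H,\psi)$ of $Y$ and every equivariant $\mathrm C^r$ lift $\tilde f\colon\tilde U\to\tilde V$ of $f|_U$, one has $\hat f([x,B])=[\tilde f(x),(d\tilde f)_x\circ B]$ for all $x\in\tilde U$ and $B\in\mathrm{GL}_n(\mathbb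 R)$ (in particular $(d\tilde f)_x$ is invertible). -/

import Mathlib

open scoped ContDiff Manifold Topology

/-- Euclidean space `ℝⁿ`. -/
abbrev Eucl (n : ℕ) : Type := EuclideanSpace ℝ (Fin n)

/-- The vector space of linear endomorphisms of `ℝⁿ`, i.e. of real `n × n` matrices. -/
abbrev EndE (n : ℕ) : Type := Eucl n →L[ℝ] Eucl n

/-- The general linear group `GL_n(ℝ)`: the group of invertible linear endomorphisms of `ℝⁿ`, with
its standard topology. -/
abbrev GLn (n : ℕ) : Type := (EndE n)ˣ

/-- A real analytic effective orbifold chart `(Ũ, G, φ)` of dimension `n` on `X`: a connected open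
set `Ũ ⊆ ℝⁿ` (`source`), a finite group `G` with a real analytic effective action on `Ũ` (`act`),
and a `G`-invariant map `φ : Ũ → X` (`proj`) inducing a homeomorphism of `Ũ / G` onto an open
subset of `X`; the last condition says that `φ` is continuous and open and that its
fibres are exactly the `G`-orbits. Only the values of `act` and `proj` on `Ũ` are relevant. -/
structure OrbifoldChart (n : ℕ) (X : Type*) [TopologicalSpace X] where
  source : Set (Eucl n)
  isOpen_source : IsOpen source
  isConnected_source : IsConnected source
  G : Type
  [group : Group G]
  [finite : Finite G]
  act : G → Eucl n → Eucl n
  mapsTo_act : ∀ g, Set.MapsTo (act g) source source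
  act_one : ∀ x ∈ source, act 1 x = x
  act_mul : ∀ g h, ∀ x ∈ source, act (g * h) x = act g (act h x)
  contDiffOn_act : ∀ g, ContDiffOn ℝ ω (act g) source
  effective : ∀ g, (∀ x ∈ source, act g x = x) → g = 1
  proj : Eucl n → X
  continuousOn_proj : ContinuousOn proj source
  isOpen_image_proj : ∀ s ⊆ source, IsOpen s → IsOpen (proj '' s)
  proj_eq_iff : ∀ x ∈ source, ∀ y ∈ source, proj x = proj y ↔ ∃ g, act g x = y

attribute [instance] OrbifoldChart.group OrbifoldChart.finite

namespace OrbifoldChart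

variable {n : ℕ} {X : Type*} [TopologicalSpace X]

/-- The open subset `U = φ(Ũ)` of `X` covered by a chart. -/
def image (U : OrbifoldChart n X) : Set X := U.proj '' U.source

/-- A real analytic embedding `(λ, θ) : (Ũ, G, φ) → (Ṽ, H, ψ)` of orbifold charts: an injective
homomorphism `θ : G → H` and a `θ`-equivariant real analytic embedding `λ : Ũ → Ṽ` with
`ψ ∘ λ = φ`. As the dimensions agree, an analytic embedding is an injective analytic map whose
differential is invertible at every point. (The condition that `θ` maps the kernel of the action
of `G` isomorphically to that of `H` is void, the actions being effective.) -/
structure Embedding (U V : OrbifoldChart n X) where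
  toFun : Eucl n → Eucl n
  hom : U.G →* V.G
  hom_injective : Function.Injective hom
  mapsTo : Set.MapsTo toFun U.source V.source
  contDiffOn : ContDiffOn ℝ ω toFun U.source
  injOn : Set.InjOn toFun U.source
  isUnit_fderiv : ∀ x ∈ U.source, IsUnit (fderiv ℝ toFun x)
  equivariant : ∀ g, ∀ x ∈ U.source, toFun (U.act g x) = V.act (hom g) (toFun x)
  proj_comp : ∀ x ∈ U.source, V.proj (toFun x) = U.proj x

end OrbifoldChart

/-- A real analytic (effective) orbifold atlas: a family of charts covering `X`, such that around
every common point of two charts there is a chart of the family embedding into both of them. -/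
structure IsOrbifoldAtlas {n : ℕ} {X : Type*} [TopologicalSpace X]
    (A : Set (OrbifoldChart n X)) : Prop where
  covers : ∀ x, ∃ U ∈ A, x ∈ U.image
  compatible : ∀ U ∈ A, ∀ V ∈ A, ∀ x ∈ U.image ∩ V.image,
    ∃ W ∈ A, x ∈ W.image ∧ Nonempty (W.Embedding U) ∧ Nonempty (W.Embedding V)

/-- A reduced real analytic `n`-orbifold with underlying space `X`: `X` is paracompact and
Hausdorff, and it is equipped with a maximal real analytic effective orbifold atlas. -/
structure ReducedAnalyticOrbifold (n : ℕ) (X : Type*) [TopologicalSpace X] where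
  t2Space : T2Space X
  paracompactSpace : ParacompactSpace X
  atlas : Set (OrbifoldChart n X)
  maximal : Maximal IsOrbifoldAtlas atlas

section Maps

variable {n : ℕ} {X Y : Type*} [TopologicalSpace X] [TopologicalSpace Y]

/-- `F : Ũ → Ṽ` is an equivariant `C^p` lift of the restriction `f|U : U → V` of `f : X → Y`. -/
structure IsLift (p : WithTop ℕ∞) (f : X → Y) (U : OrbifoldChart n X) (V : OrbifoldChart n Y)
    (F : Eucl n → Eucl n) : Prop where
  mapsTo : Set.MapsTo F U.source V.source
  contDiffOn : ContDiffOn ℝ p F U.source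
  equivariant : ∃ θ : U.G →* V.G, ∀ g, ∀ x ∈ U.source, F (U.act g x) = V.act (θ g) (F x)
  proj_comp : ∀ x ∈ U.source, V.proj (F x) = f (U.proj x)

/-- `f : X → Y` is a `C^p` orbifold map: around every point it has an equivariant `C^p` lift. -/
def IsOrbifoldMap (p : WithTop ℕ∞) (𝒳 : ReducedAnalyticOrbifold n X)
    (𝒴 : ReducedAnalyticOrbifold n Y) (f : X → Y) : Prop :=
  ∀ x, ∃ U ∈ 𝒳.atlas, x ∈ U.image ∧ ∃ V ∈ 𝒴.atlas, f x ∈ V.image ∧ ∃ F, IsLift p f U V F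

/-- A `C^p` diffeomorphism of orbifolds: a bijection which is `C^p` together with its inverse. -/
def IsOrbifoldDiffeo (p : WithTop ℕ∞) (𝒳 : ReducedAnalyticOrbifold n X)
    (𝒴 : ReducedAnalyticOrbifold n Y) (f : X ≃ Y) : Prop :=
  IsOrbifoldMap p 𝒳 𝒴 f ∧ IsOrbifoldMap p 𝒴 𝒳 f.symm

end Maps

namespace ReducedAnalyticOrbifold

variable {n : ℕ} {X : Type*} [TopologicalSpace X] (𝒳 : ReducedAnalyticOrbifold n X)

/-- The disjoint union of the frame bundles `Fr(Ũ) = Ũ × GL_n(ℝ)` over all charts of the maximal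
atlas. -/
abbrev FramePoint := Σ U : 𝒳.atlas, (U.1.source × GLn n)

/-- The identifications made in the frame bundle: `(x, B) ∼ (g x, (dg)_x ∘ B)` in `Fr(Ũ)` for
`g ∈ G`, and `(x, B) ∼ (λ x, (dλ)_x ∘ B)` for an embedding `λ : Ũ → Ṽ` of charts. -/
inductive FrameRel : 𝒳.FramePoint → 𝒳.FramePoint → Prop
  | group (U : 𝒳.atlas) (g : U.1.G) (x y : U.1.source) (B C : GLn n)
      (hy : (y : Eucl n) = U.1.act g x)
      (hC : (C : EndE n) = (fderiv ℝ (U.1.act g) x).comp (B : EndE n)) :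
      FrameRel ⟨U, x, B⟩ ⟨U, y, C⟩
  | embed (U V : 𝒳.atlas) (l : U.1.Embedding V.1) (x : U.1.source) (y : V.1.source) (B C : GLn n)
      (hy : (y : Eucl n) = l.toFun x)
      (hC : (C : EndE n) = (fderiv ℝ l.toFun x).comp (B : EndE n)) :
      FrameRel ⟨U, x, B⟩ ⟨V, y, C⟩

/-- The frame bundle `Fr(X)`: the colimit of the spaces `Fr(Ũ) / G` along the maps induced by all
embeddings of charts, i.e. the quotient of the disjoint union of the `Fr(Ũ)` by the equivalence
relation which `FrameRel` generates. -/
def FrameBundle := Quot 𝒳.FrameRel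

instance : TopologicalSpace 𝒳.FrameBundle :=
  inferInstanceAs (TopologicalSpace (Quot 𝒳.FrameRel))

/-- The canonical map `Fr(Ũ) → Fr(X)`. -/
def frameMap (U : 𝒳.atlas) (a : U.1.source × GLn n) : 𝒳.FrameBundle := Quot.mk _ ⟨U, a⟩

/-- The bundle projection `Fr(X) → X`, `[x, B] ↦ φ(x)`. -/
def frameProj : 𝒳.FrameBundle → X :=
  Quot.lift (fun a => a.1.1.proj a.2.1) (by
    rintro _ _ (⟨U, g, x, y, B, C, hy, hC⟩ | ⟨U, V, l, x, y, B, C, hy, hC⟩)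
    · exact (U.1.proj_eq_iff x x.2 y y.2).2 ⟨g, hy.symm⟩
    · simp only [hy]
      exact (l.proj_comp x x.2).symm)

/-- The right action of `GL_n(ℝ)` on `Fr(X)`: `[x, B] · A = [x, B ∘ A]`. -/
instance : MulAction (GLn n)ᵐᵒᵖ 𝒳.FrameBundle where
  smul A := Quot.map (fun a => ⟨a.1, a.2.1, a.2.2 * A.unop⟩) (by
    rintro _ _ (⟨U, g, x, y, B, C, hy, hC⟩ | ⟨U, V, l, x, y, B, C, hy, hC⟩)
    · exact .group U g x y _ _ hy (by rw [Units.val_mul, hC]; rfl)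
    · exact .embed U V l x y _ _ hy (by rw [Units.val_mul, hC]; rfl))
  one_smul p := by
    induction p using Quot.inductionOn with
    | h a => exact congrArg (Quot.mk _) (by simp)
  mul_smul A A' p := by
    induction p using Quot.inductionOn with
    | h a => exact congrArg (Quot.mk _) (by simp [mul_assoc])

/-- The open embedding `Ũ × GL_n(ℝ) → ℝⁿ × End(ℝⁿ)`. -/
def frameCoord (U : OrbifoldChart n X) (a : U.source × GLn n) : Eucl n × EndE n := (a.1, a.2)

theorem isOpenEmbedding_frameCoord (U : OrbifoldChart n X) :
    Topology.IsOpenEmbedding (frameCoord U) :=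
  U.isOpen_source.isOpenEmbedding_subtypeVal.prodMap Units.isOpenEmbedding_val

instance (U : OrbifoldChart n X) : Nonempty (U.source × GLn n) :=
  ⟨⟨_, U.isConnected_source.nonempty.choose_spec⟩, 1⟩

end ReducedAnalyticOrbifold

namespace OrbifoldChart

variable {n : ℕ} {X : Type*} [TopologicalSpace X] (U : OrbifoldChart n X)

theorem contDiffAt_act (g : U.G) {x : Eucl n} (hx : x ∈ U.source) :
    ContDiffAt ℝ ω (U.act g) x :=
  (U.contDiffOn_act g).contDiffAt (U.isOpen_source.mem_nhds hx)

theorem fderiv_act_mul (g h : U.G) {x : Eucl n} (hx : x ∈ U.source) :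
    fderiv ℝ (U.act (g * h)) x = (fderiv ℝ (U.act g) (U.act h x)).comp (fderiv ℝ (U.act h) x) := by
  have h1 : U.act (g * h) =ᶠ[𝓝 x] U.act g ∘ U.act h := by
    filter_upwards [U.isOpen_source.mem_nhds hx] with z hz using U.act_mul g h z hz
  rw [h1.fderiv_eq]
  exact fderiv_comp x ((U.contDiffAt_act g (U.mapsTo_act h hx)).differentiableAt (by simp))
    ((U.contDiffAt_act h hx).differentiableAt (by simp))

theorem fderiv_act_one {x : Eucl n} (hx : x ∈ U.source) :
    fderiv ℝ (U.act 1) x = ContinuousLinearMap.id ℝ _ := by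
  have h1 : U.act 1 =ᶠ[𝓝 x] id := by
    filter_upwards [U.isOpen_source.mem_nhds hx] with z hz using U.act_one z hz
  rw [h1.fderiv_eq, fderiv_id]

theorem act_inv_act (g : U.G) {x : Eucl n} (hx : x ∈ U.source) : U.act g⁻¹ (U.act g x) = x := by
  rw [← U.act_mul _ _ x hx, inv_mul_cancel, U.act_one x hx]

theorem act_act_inv (g : U.G) {x : Eucl n} (hx : x ∈ U.source) : U.act g (U.act g⁻¹ x) = x := by
  rw [← U.act_mul _ _ x hx, mul_inv_cancel, U.act_one x hx]

theorem isUnit_fderiv_act (g : U.G) {x : Eucl n} (hx : x ∈ U.source) :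
    IsUnit (fderiv ℝ (U.act g) x) := by
  refine ⟨⟨fderiv ℝ (U.act g) x, fderiv ℝ (U.act g⁻¹) (U.act g x), ?_, ?_⟩, rfl⟩
  · have := U.fderiv_act_mul g g⁻¹ (U.mapsTo_act g hx)
    rw [mul_inv_cancel, U.fderiv_act_one (U.mapsTo_act g hx), U.act_inv_act g hx] at this
    exact this.symm
  · have := U.fderiv_act_mul g⁻¹ g hx
    rw [inv_mul_cancel, U.fderiv_act_one hx] at this
    exact this.symm

theorem act_pow_fixed (g : U.G) {x : Eucl n} (hx : x ∈ U.source) (hgx : U.act g x = x)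
    (hd : fderiv ℝ (U.act g) x = ContinuousLinearMap.id ℝ _) (k : ℕ) :
    U.act (g ^ k) x = x ∧ fderiv ℝ (U.act (g ^ k)) x = ContinuousLinearMap.id ℝ _ := by
  induction k with
  | zero => rw [pow_zero]; exact ⟨U.act_one x hx, U.fderiv_act_one hx⟩
  | succ k ih =>
    rw [pow_succ, U.act_mul _ _ x hx, U.fderiv_act_mul _ _ hx, hgx, hd, ih.1, ih.2]
    exact ⟨rfl, rfl⟩

/-- An element of the group of a chart fixing a frame is trivial. -/
theorem eq_one_of_fixes_frame (g : U.G) {x : Eucl n} (hx : x ∈ U.source) (hgx : U.act g x = x)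
    (hd : fderiv ℝ (U.act g) x = ContinuousLinearMap.id ℝ _) : g = 1 := by
  let m := orderOf g
  have hm : 0 < m := orderOf_pos g
  let h : Eucl n → Eucl n := fun y => ∑ k ∈ Finset.range m, U.act (g ^ k) y
  have hinv : ∀ y ∈ U.source, h (U.act g y) = h y := by
    intro y hy
    have h1 : h (U.act g y) = ∑ k ∈ Finset.range m, U.act (g ^ (k + 1)) y :=
      Finset.sum_congr rfl fun k _ => by rw [pow_succ, U.act_mul _ _ y hy]
    have h2 := Finset.sum_range_succ (fun k => U.act (g ^ k) y) m
    have h3 := Finset.sum_range_succ' (fun k => U.act (g ^ k) y) m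
    simp only [m, pow_orderOf_eq_one, pow_zero] at h2 h3
    rw [h1]
    exact add_right_cancel (h3.symm.trans h2)
  have hstrict : HasStrictFDerivAt h
      (((ContinuousLinearEquiv.smulLeft (Units.mk0 (m : ℝ) (by positivity)) :
        Eucl n ≃L[ℝ] Eucl n)) : Eucl n →L[ℝ] Eucl n) x := by
    have h1 : HasStrictFDerivAt h
        (∑ k ∈ Finset.range m, ContinuousLinearMap.id ℝ (Eucl n)) x := by
      refine HasStrictFDerivAt.fun_sum fun k _ => ?_
      rw [← (U.act_pow_fixed g hx hgx hd k).2]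
      exact (U.contDiffAt_act (g ^ k) hx).hasStrictFDerivAt (by simp)
    convert h1 using 1
    ext v
    simp [ContinuousLinearEquiv.smulLeft, Units.smul_def]
  let e := hstrict.toOpenPartialHomeomorph h
  have hes : e.source ∈ 𝓝 x := e.open_source.mem_nhds hstrict.mem_toOpenPartialHomeomorph_source
  have hc : ContinuousAt (U.act g) x := (U.contDiffAt_act g hx).continuousAt
  have hfix : U.act g =ᶠ[𝓝 x] id := by
    have hes' : e.source ∈ 𝓝 (U.act g x) := by rw [hgx]; exact hes
    filter_upwards [hes, hc.preimage_mem_nhds hes', U.isOpen_source.mem_nhds hx] with y h1 h2 h3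
    exact e.injOn h2 h1 (hinv y h3)
  refine U.effective g fun y hy => ?_
  refine AnalyticOnNhd.eqOn_of_preconnected_of_eventuallyEq (𝕜 := ℝ) (f := U.act g) (g := id)
    ?_ analyticOnNhd_id U.isConnected_source.isPreconnected hx hfix hy
  exact fun z hz => (U.contDiffAt_act g hz).analyticAt

/-- A differentiable self-map germ of a chart over the identity of `X` agrees to first order with
an element of the group of the chart. -/
theorem exists_act_of_lift_id {τ : Eucl n → Eucl n} {x : Eucl n} (hx : x ∈ U.source)
    (hτ : ContDiffAt ℝ 1 τ x)
    (hid : ∀ᶠ z in 𝓝 x, τ z ∈ U.source ∧ U.proj (τ z) = U.proj z) :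
    ∃ g, U.act g x = τ x ∧ fderiv ℝ (U.act g) x = fderiv ℝ τ x := by
  have hev : ∀ᶠ z in 𝓝 x, z ∈ U.source ∧ ContinuousAt τ z ∧ ∃ g, U.act g z = τ z := by
    filter_upwards [hid, U.isOpen_source.mem_nhds hx, hτ.eventually (by simp)] with z h1 h2 h3
    exact ⟨h2, h3.continuousAt, (U.proj_eq_iff z h2 _ h1.1).1 h1.2.symm⟩
  obtain ⟨ε, hε, hb⟩ := Metric.nhds_basis_closedBall.eventually_iff.1 hev
  let K : Option U.G → Set (Eucl n) := fun o => o.elim (Metric.ball x ε)ᶜ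
    fun g => {z ∈ Metric.closedBall x ε | U.act g z = τ z}
  have hKc : ∀ o, IsClosed (K o) := by
    rintro (_ | g)
    · exact Metric.isOpen_ball.isClosed_compl
    · have hc : ContinuousOn (fun z => (U.act g z, τ z)) (Metric.closedBall x ε) := fun z hz =>
        ((U.contDiffAt_act g (hb hz).1).continuousAt.prodMk (hb hz).2.1).continuousWithinAt
      exact hc.preimage_isClosed_of_isClosed Metric.isClosed_closedBall isClosed_diagonal
  have hKu : ⋃ o, K o = Set.univ := by
    refine Set.eq_univ_of_forall fun z => Set.mem_iUnion.2 ?_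
    by_cases hz : z ∈ Metric.ball x ε
    · obtain ⟨g, hg⟩ := (hb (Metric.ball_subset_closedBall hz)).2.2
      exact ⟨some g, Metric.ball_subset_closedBall hz, hg⟩
    · exact ⟨none, hz⟩
  have hd : x ∈ closure (⋃ o, interior (K o)) := dense_iUnion_interior_of_closed hKc hKu x
  rw [closure_iUnion_of_finite, Set.mem_iUnion] at hd
  obtain ⟨_ | g, hg⟩ := hd
  · exfalso
    have h1 : x ∈ K none := closure_minimal interior_subset (hKc none) hg
    exact h1 (Metric.mem_ball_self hε)
  · have hne : (𝓝[interior (K (some g))] x).NeBot := mem_closure_iff_nhdsWithin_neBot.1 hg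
    have h1 : x ∈ K (some g) := closure_minimal interior_subset (hKc _) hg
    refine ⟨g, h1.2, ?_⟩
    have hc1 : ContinuousAt (fderiv ℝ (U.act g)) x :=
      ((U.contDiffAt_act g hx).of_le (by simp)).continuousAt_fderiv (n := 1) (by simp)
    have hc2 : ContinuousAt (fderiv ℝ τ) x := hτ.continuousAt_fderiv (by simp)
    refine tendsto_nhds_unique (l := 𝓝[interior (K (some g))] x) (hc1.mono_left nhdsWithin_le_nhds)
      ((hc2.mono_left nhdsWithin_le_nhds).congr' ?_)
    filter_upwards [self_mem_nhdsWithin] with z hz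
    refine Filter.EventuallyEq.fderiv_eq ?_
    filter_upwards [isOpen_interior.mem_nhds hz] with y hy using (interior_subset hy).2.symm

end OrbifoldChart

namespace ReducedAnalyticOrbifold

variable {n : ℕ} {X : Type*} [TopologicalSpace X] (𝒳 : ReducedAnalyticOrbifold n X)

/-- `τ` is the germ of an analytic map carrying the frame point `a` to `b`, whose action on frame
points near `a` does not change the class in `Fr(X)`. -/
def HalfGerm (a b : 𝒳.FramePoint) (τ : Eucl n → Eucl n) : Prop :=
  ContDiffAt ℝ ω τ a.2.1 ∧ τ a.2.1 = b.2.1 ∧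
    (b.2.2 : EndE n) = (fderiv ℝ τ a.2.1).comp (a.2.2 : EndE n) ∧
    ∀ᶠ z in 𝓝 (a.2.1 : Eucl n), ∀ (hz : z ∈ a.1.1.source) (C : GLn n),
      ∃ (hz' : τ z ∈ b.1.1.source) (C' : GLn n),
        (C' : EndE n) = (fderiv ℝ τ z).comp (C : EndE n) ∧
          𝒳.frameMap a.1 (⟨z, hz⟩, C) = 𝒳.frameMap b.1 (⟨τ z, hz'⟩, C')

theorem halfGerm_refl (a : 𝒳.FramePoint) : 𝒳.HalfGerm a a id := by
  refine ⟨contDiffAt_id, rfl, by simp, Filter.Eventually.of_forall fun z hz C => ⟨hz, C, ?_, rfl⟩⟩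
  simp

theorem HalfGerm.trans {a b c : 𝒳.FramePoint} {τ σ : Eucl n → Eucl n}
    (h1 : 𝒳.HalfGerm a b τ) (h2 : 𝒳.HalfGerm b c σ) : 𝒳.HalfGerm a c (σ ∘ τ) := by
  obtain ⟨s1, e1, d1, f1⟩ := h1
  obtain ⟨s2, e2, d2, f2⟩ := h2
  rw [← e1] at s2 f2
  refine ⟨s2.comp _ s1, by rw [← e2, ← e1]; rfl, ?_, ?_⟩
  · rw [fderiv_comp _ (s2.differentiableAt (by simp)) (s1.differentiableAt (by simp)), d2, d1, e1]
    rfl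
  · filter_upwards [f1, s1.continuousAt.eventually f2, s1.eventually (by simp),
      s1.continuousAt.eventually (s2.eventually (by simp))] with z g1 g2 t1 t2 hz C
    obtain ⟨hz', C', hC', hm⟩ := g1 hz C
    obtain ⟨hz'', C'', hC'', hm'⟩ := g2 hz' C'
    refine ⟨hz'', C'', ?_, hm.trans hm'⟩
    rw [fderiv_comp _ (t2.differentiableAt (by simp)) (t1.differentiableAt (by simp)), hC'', hC']
    rfl

theorem halfGerm_group (U : 𝒳.atlas) (g : U.1.G) (x y : U.1.source) (B C : GLn n)
    (hy : (y : Eucl n) = U.1.act g x)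
    (hC : (C : EndE n) = (fderiv ℝ (U.1.act g) x).comp (B : EndE n)) :
    𝒳.HalfGerm ⟨U, x, B⟩ ⟨U, y, C⟩ (U.1.act g) := by
  refine ⟨U.1.contDiffAt_act g x.2, hy.symm, hC, Filter.Eventually.of_forall fun z hz D => ?_⟩
  obtain ⟨u, hu⟩ := U.1.isUnit_fderiv_act g hz
  exact ⟨U.1.mapsTo_act g hz, u * D, by rw [← hu]; rfl,
    Quot.sound (.group U g _ _ _ _ rfl (by rw [← hu]; rfl))⟩

theorem germ_of_rel {a b : 𝒳.FramePoint} (h : 𝒳.FrameRel a b) :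
    (∃ τ, 𝒳.HalfGerm a b τ) ∧ ∃ σ, 𝒳.HalfGerm b a σ := by
  rcases h with ⟨U, g, x, y, B, C, hy, hC⟩ | ⟨U, V, l, x, y, B, C, hy, hC⟩
  · refine ⟨⟨_, 𝒳.halfGerm_group U g x y B C hy hC⟩,
      ⟨_, 𝒳.halfGerm_group U g⁻¹ y x C B ?_ ?_⟩⟩
    · rw [hy, U.1.act_inv_act g x.2]
    · have := U.1.fderiv_act_mul g⁻¹ g x.2
      rw [inv_mul_cancel, U.1.fderiv_act_one x.2] at this
      rw [hC, hy, ← ContinuousLinearMap.comp_assoc, ← this]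
      rfl
  · have hs : ∀ z ∈ U.1.source, ContDiffAt ℝ ω l.toFun z := fun z hz =>
      l.contDiffOn.contDiffAt (U.1.isOpen_source.mem_nhds hz)
    constructor
    · refine ⟨l.toFun, hs _ x.2, hy.symm, hC, Filter.Eventually.of_forall fun z hz D => ?_⟩
      obtain ⟨u, hu⟩ := l.isUnit_fderiv z hz
      exact ⟨l.mapsTo hz, u * D, by rw [← hu]; rfl,
        Quot.sound (.embed U V l _ _ _ _ rfl (by rw [← hu]; rfl))⟩
    · obtain ⟨u, hu⟩ := l.isUnit_fderiv x x.2
      have hd : HasFDerivAt l.toFun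
          ((ContinuousLinearEquiv.unitsEquiv ℝ (Eucl n) u : Eucl n ≃L[ℝ] Eucl n) :
            Eucl n →L[ℝ] Eucl n) x := by
        have := ((hs x x.2).differentiableAt (by simp)).hasFDerivAt
        rw [← hu] at this
        exact this
      let σ := (hs x x.2).localInverse hd (by simp)
      have hσ : ContDiffAt ℝ ω σ (l.toFun x) := (hs x x.2).to_localInverse hd (by simp)
      have hst := (hs x x.2).hasStrictFDerivAt' hd (by simp)
      have hσx : σ (l.toFun x) = x := hst.localInverse_apply_image
      have hr : ∀ᶠ z in 𝓝 (l.toFun x), l.toFun (σ z) = z := hst.eventually_right_inverse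
      have hsrc : ∀ᶠ z in 𝓝 (l.toFun x), σ z ∈ U.1.source :=
        hσ.continuousAt.preimage_mem_nhds
          (by rw [hσx]; exact U.1.isOpen_source.mem_nhds x.2)
      have hder : ∀ᶠ z in 𝓝 (l.toFun x), σ z ∈ U.1.source ∧ l.toFun (σ z) = z ∧
          (fderiv ℝ l.toFun (σ z)).comp (fderiv ℝ σ z) = ContinuousLinearMap.id ℝ _ := by
        filter_upwards [hr.eventually_nhds, hsrc, hσ.eventually (by simp)] with z h1 h2 h3
        refine ⟨h2, h1.self_of_nhds, ?_⟩
        rw [← fderiv_comp z ((hs _ h2).differentiableAt (by simp))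
          (h3.differentiableAt (by simp))]
        have : l.toFun ∘ σ =ᶠ[𝓝 z] id := h1
        rw [this.fderiv_eq, fderiv_id]
      have hinv : ∀ z, σ z ∈ U.1.source →
          (fderiv ℝ l.toFun (σ z)).comp (fderiv ℝ σ z) = ContinuousLinearMap.id ℝ _ →
          ∃ v : GLn n, ((v⁻¹ : GLn n) : EndE n) = fderiv ℝ σ z ∧
            (v : EndE n) = fderiv ℝ l.toFun (σ z) := by
        intro z hz hc
        obtain ⟨v, hv⟩ := l.isUnit_fderiv _ hz
        refine ⟨v, ?_, hv⟩
        rw [← hv] at hc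
        exact (Units.inv_eq_of_mul_eq_one_right hc)
      refine ⟨σ, ?_, ?_, ?_, ?_⟩
      · simpa only [hy] using hσ
      · simp only [hy]; exact hσx
      · obtain ⟨h1, h2, h3⟩ := hder.self_of_nhds
        obtain ⟨v, hv, hv'⟩ := hinv _ h1 h3
        simp only [hy, hC]
        rw [hσx] at hv'
        rw [← hv, ← hv', ← ContinuousLinearMap.comp_assoc]
        have : ((v⁻¹ : GLn n) : EndE n).comp (v : EndE n) = ContinuousLinearMap.id ℝ _ :=
          v.inv_mul
        rw [this]; rfl
      · simp only [hy]
        filter_upwards [hder] with z ⟨h1, h2, h3⟩ hz D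
        obtain ⟨v, hv, hv'⟩ := hinv _ h1 h3
        refine ⟨h1, v⁻¹ * D, by rw [← hv]; rfl, Eq.symm (Quot.sound ?_)⟩
        refine .embed U V l _ _ _ _ h2.symm ?_
        rw [← hv']
        change _ = (v : EndE n) * ((v⁻¹ * D : GLn n) : EndE n)
        rw [← Units.val_mul, mul_inv_cancel_left]

theorem germ_of_eq {a b : 𝒳.FramePoint} (h : 𝒳.frameMap a.1 a.2 = 𝒳.frameMap b.1 b.2) :
    ∃ τ, 𝒳.HalfGerm a b τ := by
  have h' : Relation.EqvGen 𝒳.FrameRel a b := Quot.eqvGen_exact h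
  suffices H : (∃ τ, 𝒳.HalfGerm a b τ) ∧ ∃ σ, 𝒳.HalfGerm b a σ from H.1
  clear h
  induction h' with
  | rel a b h => exact 𝒳.germ_of_rel h
  | refl a => exact ⟨⟨_, 𝒳.halfGerm_refl a⟩, ⟨_, 𝒳.halfGerm_refl a⟩⟩
  | symm a b _ ih => exact ih.symm
  | trans a b c _ _ h1 h2 =>
    obtain ⟨⟨t1, h1⟩, ⟨s1, k1⟩⟩ := h1
    obtain ⟨⟨t2, h2⟩, ⟨s2, k2⟩⟩ := h2
    exact ⟨⟨_, h1.trans 𝒳 h2⟩, ⟨_, k2.trans 𝒳 k1⟩⟩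

/-- Points of `Fr(Ũ)` with the same image in `Fr(X)` differ by an element of the group. -/
theorem exists_act_of_frameMap_eq {U : 𝒳.atlas} {a b : U.1.source × GLn n}
    (h : 𝒳.frameMap U a = 𝒳.frameMap U b) :
    ∃ g, U.1.act g a.1 = b.1 ∧ (b.2 : EndE n) = (fderiv ℝ (U.1.act g) a.1).comp (a.2 : EndE n) := by
  obtain ⟨τ, h1, h2, h3, h4⟩ := 𝒳.germ_of_eq (a := ⟨U, a⟩) (b := ⟨U, b⟩) h
  dsimp only at h1 h2 h3 h4
  obtain ⟨g, hg, hd⟩ := U.1.exists_act_of_lift_id a.1.2 (h1.of_le (by simp)) (by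
    filter_upwards [h4, U.1.isOpen_source.mem_nhds a.1.2] with z h5 hz
    obtain ⟨hz', C', -, hm⟩ := h5 hz 1
    exact ⟨hz', (congrArg 𝒳.frameProj hm).symm⟩)
  exact ⟨g, hg.trans h2, by rw [hd, h3]⟩

theorem HalfGerm.continuousAt {a b : 𝒳.FramePoint} {τ : Eucl n → Eucl n}
    (h : 𝒳.HalfGerm a b τ) :
    ContDiffAt ℝ ω (fun q : Eucl n × EndE n => (τ q.1, (fderiv ℝ τ q.1).comp q.2))
      (frameCoord a.1.1 a.2) := by
  have h1 : ContDiffAt ℝ ω τ (frameCoord a.1.1 a.2).1 := h.1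
  have h2 : ContDiffAt ℝ ω (fderiv ℝ τ) (frameCoord a.1.1 a.2).1 := h1.fderiv_right (by simp)
  exact (h1.comp _ contDiffAt_fst).prodMk ((h2.comp _ contDiffAt_fst).clm_comp contDiffAt_snd)

theorem HalfGerm.eventually {a b : 𝒳.FramePoint} {τ : Eucl n → Eucl n}
    (h : 𝒳.HalfGerm a b τ) {O : Set (b.1.1.source × GLn n)} (hO : IsOpen O) (hb : b.2 ∈ O) :
    ∀ᶠ a' in 𝓝 a.2, ∃ b' ∈ O,
      frameCoord b.1.1 b' = (τ a'.1, (fderiv ℝ τ a'.1).comp (a'.2 : EndE n)) ∧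
        𝒳.frameMap a.1 a' = 𝒳.frameMap b.1 b' := by
  have hO' := (isOpenEmbedding_frameCoord b.1.1).isOpenMap O hO
  have hc : ContinuousAt (fun q : Eucl n × EndE n => (τ q.1, (fderiv ℝ τ q.1).comp q.2))
      (frameCoord a.1.1 a.2) := (h.continuousAt 𝒳).continuousAt
  have hab : (fun q : Eucl n × EndE n => (τ q.1, (fderiv ℝ τ q.1).comp q.2))
      (frameCoord a.1.1 a.2) = frameCoord b.1.1 b.2 := Prod.ext h.2.1 h.2.2.1.symm
  have h1 := hc.preimage_mem_nhds (hab ▸ hO'.mem_nhds ⟨_, hb, rfl⟩)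
  have h2 := (isOpenEmbedding_frameCoord a.1.1).continuous.continuousAt.preimage_mem_nhds h1
  have h3 : ContinuousAt (fun a' : a.1.1.source × GLn n => (a'.1 : Eucl n)) a.2 := by fun_prop
  filter_upwards [h2, h3.eventually h.2.2.2] with a' ⟨b', hb', e⟩ h4
  refine ⟨b', hb', e, ?_⟩
  obtain ⟨hz, C', hC', hm⟩ := h4 a'.1.2 a'.2
  have : b' = (⟨τ a'.1, hz⟩, C') :=
    (isOpenEmbedding_frameCoord b.1.1).injective (e.trans (Prod.ext rfl hC'.symm))
  rw [this]
  exact hm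

theorem continuous_frameMap (U : 𝒳.atlas) : Continuous (𝒳.frameMap U) :=
  continuous_quot_mk.comp (continuous_sigmaMk (σ := fun U : 𝒳.atlas => U.1.source × GLn n))

theorem isOpenMap_frameMap (U : 𝒳.atlas) : IsOpenMap (𝒳.frameMap U) := by
  intro O hO
  refine isQuotientMap_quot_mk.isOpen_preimage.1 (isOpen_sigma_iff.2 fun V => ?_)
  refine isOpen_iff_mem_nhds.2 fun b ⟨a, ha, e⟩ => ?_
  obtain ⟨τ, hτ⟩ := 𝒳.germ_of_eq (a := ⟨V, b⟩) (b := ⟨U, a⟩) e.symm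
  filter_upwards [hτ.eventually 𝒳 hO ha] with b' ⟨a', ha', _, hm⟩
  exact ⟨a', ha', hm.symm⟩

theorem exists_injOn_frameMap (U : 𝒳.atlas) (a : U.1.source × GLn n) :
    ∃ N, IsOpen N ∧ a ∈ N ∧ Set.InjOn (𝒳.frameMap U) N := by
  let Φ : U.1.G → U.1.source × GLn n → Eucl n × EndE n := fun g p =>
    (U.1.act g p.1, (fderiv ℝ (U.1.act g) p.1).comp (p.2 : EndE n))
  have hΦ : ∀ g, ContinuousAt (Φ g) a := by
    intro g
    have h1 : ContinuousAt (fun p : U.1.source × GLn n => (p.1 : Eucl n)) a := by fun_prop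
    have h2 : ContinuousAt (fun p : U.1.source × GLn n => (p.2 : EndE n)) a :=
      (Units.continuous_val.comp continuous_snd).continuousAt
    have h3 := U.1.contDiffAt_act g a.1.2
    have h4 : ContDiffAt ℝ ω (fderiv ℝ (U.1.act g)) a.1 := h3.fderiv_right (by simp)
    exact (ContinuousAt.comp (f := fun p : U.1.source × GLn n => (p.1 : Eucl n))
      h3.continuousAt h1).prodMk ((ContinuousAt.comp
        (f := fun p : U.1.source × GLn n => (p.1 : Eucl n)) h4.continuousAt h1).clm_comp h2)
  have hev : ∀ g, ∀ᶠ pq in 𝓝 a ×ˢ 𝓝 a, g ≠ 1 → Φ g pq.1 ≠ frameCoord U.1 pq.2 := by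
    intro g
    by_cases hg : g = 1
    · exact Filter.Eventually.of_forall fun _ h => absurd hg h
    have hne : Φ g a ≠ frameCoord U.1 a := by
      intro h
      refine hg (U.1.eq_one_of_fixes_frame g a.1.2 (congrArg Prod.fst h) ?_)
      have h2 : fderiv ℝ (U.1.act g) a.1 * (a.2 : EndE n) = 1 * (a.2 : EndE n) := by
        rw [one_mul]; exact congrArg Prod.snd h
      exact a.2.isUnit.mul_right_cancel h2
    obtain ⟨A, B, hA, hB, haA, haB, hd⟩ := t2_separation hne
    have h1 := (hΦ g).preimage_mem_nhds (hA.mem_nhds haA)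
    have h2 := (isOpenEmbedding_frameCoord U.1).continuous.continuousAt.preimage_mem_nhds
      (hB.mem_nhds haB)
    filter_upwards [Filter.prod_mem_prod h1 h2] with pq hpq _
    exact fun h => Set.disjoint_left.1 hd hpq.1 (h ▸ hpq.2)
  obtain ⟨N, ⟨haN, hN⟩, hNs⟩ := ((nhds_basis_opens a).prod_self.eventually_iff).1
    (Filter.eventually_all.2 hev)
  refine ⟨N, hN, haN, fun p hp q hq hpq => ?_⟩
  obtain ⟨g, h1, h2⟩ := 𝒳.exists_act_of_frameMap_eq hpq
  have hg : g = 1 := by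
    by_contra hg
    exact hNs (x := (p, q)) ⟨hp, hq⟩ g hg (Prod.ext h1 h2.symm)
  subst hg
  rw [U.1.act_one _ p.1.2] at h1
  rw [U.1.fderiv_act_one p.1.2] at h2
  exact Prod.ext (Subtype.ext h1) (Units.ext h2.symm)

/-- The canonical maps `Fr(Ũ) → Fr(X)` are local homeomorphisms. -/
theorem isLocalHomeomorph_frameMap (U : 𝒳.atlas) : IsLocalHomeomorph (𝒳.frameMap U) := by
  refine IsLocalHomeomorph.mk _ fun a => ?_
  obtain ⟨N, hN, haN, hinj⟩ := 𝒳.exists_injOn_frameMap U a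
  exact ⟨OpenPartialHomeomorph.ofContinuousOpen (hinj.toPartialEquiv _ _)
    (𝒳.continuous_frameMap U).continuousOn (𝒳.isOpenMap_frameMap U) hN, haN, fun _ _ => rfl⟩

/-- The manifold charts of `Fr(X)`: the local inverses of the canonical maps
`Ũ × GL_n(ℝ) → Fr(X)`, with `Ũ × GL_n(ℝ)` regarded as an open subset of `ℝⁿ × End(ℝⁿ)`. -/
def frameAtlas : Set (OpenPartialHomeomorph 𝒳.FrameBundle (Eucl n × EndE n)) :=
  {c | ∃ (U : 𝒳.atlas) (e : OpenPartialHomeomorph (U.1.source × GLn n) 𝒳.FrameBundle),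
    Set.EqOn e (𝒳.frameMap U) e.source ∧
      c = e.symm.trans ((isOpenEmbedding_frameCoord U.1).toOpenPartialHomeomorph _)}

theorem exists_mem_frameAtlas (p : 𝒳.FrameBundle) : ∃ c ∈ 𝒳.frameAtlas, p ∈ c.source := by
  induction p using Quot.inductionOn with
  | h a =>
    obtain ⟨e, ha, he⟩ := 𝒳.isLocalHomeomorph_frameMap a.1 a.2
    refine ⟨_, ⟨a.1, e, fun x _ => congrFun he.symm x, rfl⟩, ?_⟩
    have : Quot.mk 𝒳.FrameRel a = e a.2 := congrFun he a.2
    simp only [OpenPartialHomeomorph.trans_source, OpenPartialHomeomorph.symm_source]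
    refine ⟨this ▸ e.map_source ha, ?_⟩
    rw [Topology.IsOpenEmbedding.toOpenPartialHomeomorph_source]
    trivial

noncomputable instance : ChartedSpace (Eucl n × EndE n) 𝒳.FrameBundle where
  atlas := 𝒳.frameAtlas
  chartAt p := (𝒳.exists_mem_frameAtlas p).choose
  mem_chart_source p := (𝒳.exists_mem_frameAtlas p).choose_spec.2
  chart_mem_atlas p := (𝒳.exists_mem_frameAtlas p).choose_spec.1

/-- `Fr(X)` is a real analytic manifold. -/
instance : IsManifold 𝓘(ℝ, Eucl n × EndE n) ω 𝒳.FrameBundle := by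
  refine isManifold_of_contDiffOn _ _ _ ?_
  rintro _ _ ⟨U, e, he, rfl⟩ ⟨V, e', he', rfl⟩ q hq
  simp only [modelWithCornersSelf_coe, modelWithCornersSelf_coe_symm, Set.range_id, Set.inter_univ,
    Set.preimage_id, Function.comp_id, Function.id_comp] at hq ⊢
  set κ := (isOpenEmbedding_frameCoord U.1).toOpenPartialHomeomorph _ with hκ
  set κ' := (isOpenEmbedding_frameCoord V.1).toOpenPartialHomeomorph _ with hκ'
  refine ContDiffAt.contDiffWithinAt ?_
  rw [OpenPartialHomeomorph.trans_source] at hq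
  obtain ⟨hq1, hq2⟩ := hq
  have hq1' : q ∈ κ.target ∧ κ.symm q ∈ e.source := by simpa using hq1
  have hq2' : e (κ.symm q) ∈ e'.target := (by simpa using hq2 :
    e (κ.symm q) ∈ e'.target ∧ e'.symm (e (κ.symm q)) ∈ κ'.source).1
  set a := κ.symm q with ha
  have hqa : q = frameCoord U.1 a := (κ.right_inv hq1'.1).symm
  set b := e'.symm (e a) with hb
  have hbs : b ∈ e'.source := e'.map_target hq2'
  have hab : 𝒳.frameMap U a = 𝒳.frameMap V b := by
    rw [← he hq1'.2, ← he' hbs, hb, e'.right_inv hq2']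
  obtain ⟨τ, hτ⟩ := 𝒳.germ_of_eq (a := ⟨U, a⟩) (b := ⟨V, b⟩) hab
  have hs := hτ.continuousAt 𝒳
  have hqq : frameCoord U.1 a = q := hqa.symm
  simp only [hqq] at hs
  refine hs.congr_of_eventuallyEq ?_
  have hev := hτ.eventually 𝒳 e'.open_source hbs
  have hκc : ContinuousAt κ.symm q := κ.continuousAt_symm hq1'.1
  filter_upwards [hκc.eventually hev, hκc.preimage_mem_nhds (e.open_source.mem_nhds hq1'.2),
    κ.open_target.mem_nhds hq1'.1] with p ⟨b', hb', hc, hm⟩ hp1 hp2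
  have hp : frameCoord U.1 (κ.symm p) = p := κ.right_inv hp2
  have h1 : e (κ.symm p) = e' b' := by
    rw [he hp1, he' hb']; exact hm
  have h2 : κ' (e'.symm (e (κ.symm p))) = frameCoord V.1 b' := by
    rw [h1, e'.left_inv hb']; rfl
  have h3 : (κ.symm p).1 = p.1 ∧ ((κ.symm p).2 : EndE n) = p.2 :=
    ⟨congrArg Prod.fst hp, congrArg Prod.snd hp⟩
  rw [h3.1, h3.2] at hc
  exact h2.trans hc

end ReducedAnalyticOrbifold

/-- `F : Fr(X) → Fr(Y)` is induced by the `C^r` orbifold diffeomorphism `f : X → Y`: for all charts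
and for every equivariant `C^r` lift `f̃ : Ũ → Ṽ` of `f|U`, the map `F` is given on frames by
`[x, B] ↦ [f̃ x, (df̃)_x ∘ B]` (in particular `(df̃)_x ∘ B` is again a frame). -/
def IsInducedFrameMap {n : ℕ} {X Y : Type*} [TopologicalSpace X] [TopologicalSpace Y]
    (r : WithTop ℕ∞) (𝒳 : ReducedAnalyticOrbifold n X) (𝒴 : ReducedAnalyticOrbifold n Y)
    (f : X → Y) (F : 𝒳.FrameBundle → 𝒴.FrameBundle) : Prop :=
  ∀ (U : 𝒳.atlas) (V : 𝒴.atlas) (φ : Eucl n → Eucl n) (h : IsLift r f U.1 V.1 φ)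
    (x : U.1.source) (B : GLn n), ∃ C : GLn n,
      (C : EndE n) = (fderiv ℝ φ x).comp (B : EndE n) ∧
        F (𝒳.frameMap U (x, B)) = 𝒴.frameMap V (⟨φ x, h.mapsTo x.2⟩, C)

/-! A frame $[x,B]$ should go to $[\tilde f(x),(d\tilde f)_x\circ B]$. The points to settle are that
$(d\tilde f)_x$ is invertible and that the result depends neither on the representative nor on the
lift.

Both come from a rigidity statement for $C^1$ germs. If $a$ and $b$ map into one chart and induce
the same map to the space, then near $x$ each $b(z)$ is some $g\cdot a(z)$. The element $g$ may vary
with $z$, but the group is finite, so a single $g$ works on an open set accumulating at $x$; by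
continuity $g\circ a$ and $b$ have the same value and differential at $x$. Frames see only these
first-order data. For different target charts, `germ_of_eq` supplies an analytic change of charts.
The result is `frameMap_eq_of_proj_eventuallyEq`: if $da\circ B$ is a frame, then $db\circ B$ is one
too, with the same class.

With $a$ and $b$ two lifts of $f$ this gives independence of choices. With $a=\mathrm{id}$ and
$b=\psi\circ\tau\circ\varphi$, for a lift $\psi$ of $f^{-1}$ and a change of charts $\tau$, it shows
that $d\varphi$ has a left inverse, hence is invertible, and that the maps induced by $f$ and
$f^{-1}$ are mutually inverse. Smoothness is read off from the local form
$(x,B)\mapsto(\varphi(x),d\varphi_x\circ B)$, which involves one derivative of $\varphi$. -/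

/-! ### First-order rigidity of germs into a chart -/

namespace OrbifoldChart

variable {n : ℕ} {X : Type*} [TopologicalSpace X] (U : OrbifoldChart n X)

/-- Two continuously differentiable germs into a chart which induce the same map to `X` agree to
first order up to an element of the group of the chart. -/
theorem exists_act_of_proj_eventuallyEq {a b : Eucl n → Eucl n} {x : Eucl n}
    (ha : ContDiffAt ℝ 1 a x) (hb : ContDiffAt ℝ 1 b x)
    (hab : ∀ᶠ z in 𝓝 x, a z ∈ U.source ∧ b z ∈ U.source ∧ U.proj (a z) = U.proj (b z)) :
    ∃ g, U.act g (a x) = b x ∧ (fderiv ℝ (U.act g) (a x)).comp (fderiv ℝ a x) = fderiv ℝ b x := by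
  have hev : ∀ᶠ z in 𝓝 x, a z ∈ U.source ∧ ContinuousAt a z ∧ ContinuousAt b z ∧
      ∃ g, U.act g (a z) = b z := by
    filter_upwards [hab, ha.eventually (by simp), hb.eventually (by simp)] with z h1 h2 h3
    exact ⟨h1.1, h2.continuousAt, h3.continuousAt, (U.proj_eq_iff _ h1.1 _ h1.2.1).1 h1.2.2⟩
  obtain ⟨ε, hε, hball⟩ := Metric.nhds_basis_closedBall.eventually_iff.1 hev
  -- The index `none` carries the complement of the open ball, so that finitely many closed sets
  -- cover all of `ℝⁿ` and the density of the union of their interiors applies directly. Being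
  -- closed and not containing `x`, it is not the piece that accumulates at `x`.
  let K : Option U.G → Set (Eucl n) := fun o => o.elim (Metric.ball x ε)ᶜ
    fun g => {z ∈ Metric.closedBall x ε | U.act g (a z) = b z}
  have hKc : ∀ o, IsClosed (K o) := by
    rintro (_ | g)
    · exact Metric.isOpen_ball.isClosed_compl
    · have hc : ContinuousOn (fun z => (U.act g (a z), b z)) (Metric.closedBall x ε) :=
        fun z hz => ((ContinuousAt.comp (f := a) (U.contDiffAt_act g (hball hz).1).continuousAt
          (hball hz).2.1).prodMk (hball hz).2.2.1).continuousWithinAt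
      exact hc.preimage_isClosed_of_isClosed Metric.isClosed_closedBall isClosed_diagonal
  have hKu : ⋃ o, K o = Set.univ := by
    refine Set.eq_univ_of_forall fun z => Set.mem_iUnion.2 ?_
    by_cases hz : z ∈ Metric.ball x ε
    · obtain ⟨g, hg⟩ := (hball (Metric.ball_subset_closedBall hz)).2.2.2
      exact ⟨some g, Metric.ball_subset_closedBall hz, hg⟩
    · exact ⟨none, hz⟩
  have hd : x ∈ closure (⋃ o, interior (K o)) := dense_iUnion_interior_of_closed hKc hKu x
  rw [closure_iUnion_of_finite, Set.mem_iUnion] at hd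
  obtain ⟨_ | g, hg⟩ := hd
  · exfalso
    have h1 : x ∈ K none := closure_minimal interior_subset (hKc none) hg
    exact h1 (Metric.mem_ball_self hε)
  · have hne : (𝓝[interior (K (some g))] x).NeBot := mem_closure_iff_nhdsWithin_neBot.1 hg
    have h1 : x ∈ K (some g) := closure_minimal interior_subset (hKc _) hg
    refine ⟨g, h1.2, ?_⟩
    have hax : a x ∈ U.source := hab.self_of_nhds.1
    have hga : ContDiffAt ℝ 1 (U.act g ∘ a) x :=
      ((U.contDiffAt_act g hax).of_le (by simp)).comp x ha
    rw [← fderiv_comp x ((U.contDiffAt_act g hax).differentiableAt (by simp))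
      (ha.differentiableAt (by simp))]
    have hc1 : ContinuousAt (fderiv ℝ (U.act g ∘ a)) x := hga.continuousAt_fderiv (by simp)
    have hc2 : ContinuousAt (fderiv ℝ b) x := hb.continuousAt_fderiv (by simp)
    -- On the interior of `K (some g)` the two maps agree locally, hence so do their derivatives;
    -- both derivatives are continuous at `x`, a limit point of this interior.
    refine tendsto_nhds_unique (l := 𝓝[interior (K (some g))] x) (hc1.mono_left nhdsWithin_le_nhds)
      ((hc2.mono_left nhdsWithin_le_nhds).congr' ?_)
    filter_upwards [self_mem_nhdsWithin] with z hz
    refine Filter.EventuallyEq.fderiv_eq ?_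
    filter_upwards [isOpen_interior.mem_nhds hz] with y hy using (interior_subset hy).2.symm

end OrbifoldChart

/-- In finite dimension a left inverse is two-sided. -/
theorem ContinuousLinearMap.isUnit_of_comp_eq_id {n : ℕ} {A B : EndE n}
    (h : A.comp B = ContinuousLinearMap.id ℝ _) : IsUnit B := by
  have h1 : (A : Eucl n →ₗ[ℝ] Eucl n) * (B : Eucl n →ₗ[ℝ] Eucl n) = 1 :=
    congrArg ContinuousLinearMap.toLinearMap h
  refine ⟨⟨B, A, ?_, h⟩, rfl⟩
  ext1 v
  exact LinearMap.congr_fun (mul_eq_one_comm.1 h1) v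

namespace ReducedAnalyticOrbifold

variable {n : ℕ} {X Y : Type*} [TopologicalSpace X] [TopologicalSpace Y]

/-! ### Representing and comparing frames in different orbifold charts -/

section Frames

variable (𝒳 : ReducedAnalyticOrbifold n X)

theorem frameMap_eq_of_act {U : 𝒳.atlas} (g : U.1.G) {x y : U.1.source} {B C : GLn n}
    (hy : (y : Eucl n) = U.1.act g x)
    (hC : (C : EndE n) = (fderiv ℝ (U.1.act g) x).comp (B : EndE n)) :
    𝒳.frameMap U (x, B) = 𝒳.frameMap U (y, C) :=
  Quot.sound (.group U g x y B C hy hC)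

theorem frameMap_eq_of_embedding {U V : 𝒳.atlas} (l : U.1.Embedding V.1) {x : U.1.source}
    {y : V.1.source} {B C : GLn n} (hy : (y : Eucl n) = l.toFun x)
    (hC : (C : EndE n) = (fderiv ℝ l.toFun x).comp (B : EndE n)) :
    𝒳.frameMap U (x, B) = 𝒳.frameMap V (y, C) :=
  Quot.sound (.embed U V l x y B C hy hC)

/-- A chart embedding maps onto the frames over its image: each frame of the target chart over a
point in the image of the source chart is represented in the source chart. -/
theorem exists_frameMap_eq_of_embedding {W U : 𝒳.atlas} (l : W.1.Embedding U.1)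
    (a : U.1.source × GLn n) (w : W.1.source) (hw : W.1.proj w = U.1.proj a.1) :
    ∃ B, 𝒳.frameMap W (w, B) = 𝒳.frameMap U a := by
  obtain ⟨g, hg⟩ := (U.1.proj_eq_iff _ (l.mapsTo w.2) _ a.1.2).1
    ((l.proj_comp w w.2).trans hw)
  obtain ⟨u, hu⟩ := l.isUnit_fderiv w w.2
  obtain ⟨v, hv⟩ := U.1.isUnit_fderiv_act g (l.mapsTo w.2)
  -- Here `u` is the differential of the embedding at `w` and `v` that of the group element carrying
  -- `l w` to the base point of `a`; the witness is the frame at `w` which their composite sends to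
  -- `a.2`.
  refine ⟨u⁻¹ * v⁻¹ * a.2, ?_⟩
  rw [𝒳.frameMap_eq_of_embedding l (y := ⟨_, l.mapsTo w.2⟩) (C := v⁻¹ * a.2) rfl ?_,
    𝒳.frameMap_eq_of_act g (y := a.1) (C := a.2) hg.symm ?_]
  · rw [← hv]
    change _ = (v : EndE n) * ((v⁻¹ * a.2 : GLn n) : EndE n)
    rw [← Units.val_mul, mul_inv_cancel_left]
  · rw [← hu]
    change _ = (u : EndE n) * ((u⁻¹ * v⁻¹ * a.2 : GLn n) : EndE n)
    rw [← Units.val_mul, mul_assoc, mul_inv_cancel_left]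

/-- A frame can be represented in every chart around its base point. -/
theorem exists_frameMap_eq {U U' : 𝒳.atlas} (a : U.1.source × GLn n)
    (ha : U.1.proj a.1 ∈ U'.1.image) : ∃ b, 𝒳.frameMap U a = 𝒳.frameMap U' b := by
  obtain ⟨W, hW, ⟨w, hw, hwa⟩, ⟨l⟩, ⟨l'⟩⟩ := 𝒳.maximal.prop.compatible U.1 U.2 U'.1 U'.2 _
    ⟨⟨_, a.1.2, rfl⟩, ha⟩
  obtain ⟨B, hB⟩ := 𝒳.exists_frameMap_eq_of_embedding (W := ⟨W, hW⟩) l a ⟨w, hw⟩ hwa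
  obtain ⟨u, hu⟩ := l'.isUnit_fderiv w hw
  refine ⟨(⟨_, l'.mapsTo hw⟩, u * B), ?_⟩
  rw [← hB]
  exact 𝒳.frameMap_eq_of_embedding (U := ⟨W, hW⟩) l' rfl (by rw [← hu]; rfl)

/-- Since `τ` preserves the classes of nearby frames, projecting to `X` shows that it covers the
identity; any frame at `z` serves for this, for instance the identity frame. -/
theorem HalfGerm.proj_eventuallyEq {a b : 𝒳.FramePoint} {τ : Eucl n → Eucl n}
    (h : 𝒳.HalfGerm a b τ) :
    ∀ᶠ z in 𝓝 (a.2.1 : Eucl n), τ z ∈ b.1.1.source ∧ b.1.1.proj (τ z) = a.1.1.proj z := by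
  filter_upwards [h.2.2.2, a.1.1.isOpen_source.mem_nhds a.2.1.2] with z h1 hz
  obtain ⟨hz', C', -, hm⟩ := h1 hz 1
  exact ⟨hz', (congrArg 𝒳.frameProj hm).symm⟩

/-- Continuously differentiable germs into charts of an orbifold which induce the same map to the
underlying space carry frames to the same points of the frame bundle. -/
theorem frameMap_eq_of_proj_eventuallyEq {V V' : 𝒳.atlas} {a b : Eucl n → Eucl n} {x : Eucl n}
    (ha : ContDiffAt ℝ 1 a x) (hb : ContDiffAt ℝ 1 b x)
    (hab : ∀ᶠ z in 𝓝 x, a z ∈ V.1.source ∧ b z ∈ V'.1.source ∧ V.1.proj (a z) = V'.1.proj (b z))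
    (hax : a x ∈ V.1.source) (hbx : b x ∈ V'.1.source) {B : EndE n} {C : GLn n}
    (hC : (C : EndE n) = (fderiv ℝ a x).comp B) :
    ∃ D : GLn n, (D : EndE n) = (fderiv ℝ b x).comp B ∧
      𝒳.frameMap V (⟨a x, hax⟩, C) = 𝒳.frameMap V' (⟨b x, hbx⟩, D) := by
  obtain ⟨c, hc⟩ := 𝒳.exists_frameMap_eq (U := V) (U' := V') (⟨a x, hax⟩, C)
    ⟨b x, hbx, hab.self_of_nhds.2.2.symm⟩
  -- The germ `τ` is an analytic change of charts from `V` to `V'`. Thus `τ ∘ a` and `b` both take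
  -- values in `V'`, where rigidity applies; the resulting `g` then moves the frame `c` to the one
  -- over `b x`.
  obtain ⟨τ, hτ⟩ := 𝒳.germ_of_eq (a := ⟨V, ⟨a x, hax⟩, C⟩) (b := ⟨V', c⟩) hc
  have hτs : ContDiffAt ℝ ω τ (a x) := hτ.1
  have hτa : ContDiffAt ℝ 1 (τ ∘ a) x := (hτs.of_le (by simp)).comp x ha
  have hcx : (c.1 : Eucl n) = τ (a x) := hτ.2.1.symm
  obtain ⟨g, hg, hd⟩ := V'.1.exists_act_of_proj_eventuallyEq hτa hb (by
    filter_upwards [hab, ha.continuousAt.eventually (hτ.proj_eventuallyEq 𝒳)] with z h1 h2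
    exact ⟨h2.1, h1.2.1, h2.2.trans h1.2.2⟩)
  rw [fderiv_comp x (hτs.differentiableAt (by simp)) (ha.differentiableAt (by simp))] at hd
  have hgc : V'.1.act g c.1 = b x := by rw [hcx]; exact hg
  have hc2 : (c.2 : EndE n) = (fderiv ℝ τ (a x)).comp (C : EndE n) := hτ.2.2.1
  -- The invertibility of `fderiv ℝ b x ∘ B` comes from here: it equals `v * c.2`, a product of two
  -- invertible maps.
  obtain ⟨v, hv⟩ := V'.1.isUnit_fderiv_act g c.1.2
  have hvc : ((v * c.2 : GLn n) : EndE n) = (fderiv ℝ (V'.1.act g) c.1).comp (c.2 : EndE n) := by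
    rw [← hv]; rfl
  refine ⟨v * c.2, ?_, hc.trans (𝒳.frameMap_eq_of_act g hgc.symm hvc)⟩
  rw [hvc, hc2, hC, ← hd, hcx]
  rfl

/-- Around each frame there is a manifold chart of `Fr(X)` inverse to the canonical map
`Fr(Ũ) → Fr(X)`. -/
theorem exists_frameAtlas_chart (U : 𝒳.atlas) (a : U.1.source × GLn n) :
    ∃ c ∈ 𝒳.frameAtlas, 𝒳.frameMap U a ∈ c.source ∧ c (𝒳.frameMap U a) = frameCoord U.1 a ∧
      (∀ p ∈ c.source, ∃ b, 𝒳.frameMap U b = p ∧ c p = frameCoord U.1 b) ∧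
      ∀ b, c.symm (frameCoord U.1 b) = 𝒳.frameMap U b := by
  obtain ⟨e, ha, he⟩ := 𝒳.isLocalHomeomorph_frameMap U a
  set κ := (isOpenEmbedding_frameCoord U.1).toOpenPartialHomeomorph _ with hκ
  have hs : κ.source = Set.univ := by simp [hκ]
  have hl : ∀ b, κ.symm (frameCoord U.1 b) = b := fun b => κ.left_inv (by rw [hs]; trivial)
  have hmem : ∀ p ∈ e.target, p ∈ (e.symm.trans κ).source := fun p hp => by simp [hs, hp]
  have hp : 𝒳.frameMap U a ∈ (e.symm.trans κ).source := hmem _ (by rw [he]; exact e.map_source ha)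
  have hca : (e.symm.trans κ) (𝒳.frameMap U a) = frameCoord U.1 a := by
    change frameCoord U.1 (e.symm (𝒳.frameMap U a)) = _
    rw [he, e.left_inv ha]
  refine ⟨e.symm.trans κ, ⟨U, e, fun x _ => congrFun he.symm x, rfl⟩, hp, hca, ?_, ?_⟩
  · intro p hp
    -- The frame over `p` is the value at `p` of the local section of `𝒳.frameMap U` given by
    -- `e.symm`.
    refine ⟨e.symm p, ?_, rfl⟩
    rw [OpenPartialHomeomorph.trans_source] at hp
    rw [he]
    exact e.right_inv hp.1
  -- No condition on `b` is needed: `e` equals `𝒳.frameMap U` as a total function, and the source of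
  -- `κ` is everything.
  · intro b
    change e (κ.symm (frameCoord U.1 b)) = _
    rw [hl, he]

end Frames

/-! ### The action of lifts on frames -/

variable {𝒳 : ReducedAnalyticOrbifold n X} {𝒴 : ReducedAnalyticOrbifold n Y} {r : WithTop ℕ∞}

theorem _root_.IsLift.contDiffAt {f : X → Y} {U : OrbifoldChart n X} {V : OrbifoldChart n Y}
    {φ : Eucl n → Eucl n} (h : IsLift r f U V φ) {x : Eucl n} (hx : x ∈ U.source) :
    ContDiffAt ℝ r φ x :=
  h.contDiffOn.contDiffAt (U.isOpen_source.mem_nhds hx)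

/-- The images of a frame under two lifts of the same map agree. -/
theorem frameMap_eq_of_isLift (hr : 1 ≤ r) {f : X → Y} {U U' : 𝒳.atlas} {V V' : 𝒴.atlas}
    {φ φ' : Eucl n → Eucl n} (h : IsLift r f U.1 V.1 φ) (h' : IsLift r f U'.1 V'.1 φ')
    {x : U.1.source} {x' : U'.1.source} {B B' C : GLn n}
    (hx : 𝒳.frameMap U (x, B) = 𝒳.frameMap U' (x', B'))
    (hC : (C : EndE n) = (fderiv ℝ φ x).comp (B : EndE n)) :
    ∃ D : GLn n, (D : EndE n) = (fderiv ℝ φ' x').comp (B' : EndE n) ∧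
      𝒴.frameMap V (⟨φ x, h.mapsTo x.2⟩, C) = 𝒴.frameMap V' (⟨φ' x', h'.mapsTo x'.2⟩, D) := by
  obtain ⟨τ, hτ⟩ := 𝒳.germ_of_eq (a := ⟨U, x, B⟩) (b := ⟨U', x', B'⟩) hx
  have hτs : ContDiffAt ℝ ω τ x := hτ.1
  have hτx : τ x = x' := hτ.2.1
  have hφ' : ContDiffAt ℝ r φ' (τ x) := h'.contDiffAt (by rw [hτx]; exact x'.2)
  have hB' : (B' : EndE n) = (fderiv ℝ τ x).comp (B : EndE n) := hτ.2.2.1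
  have hm : (φ' ∘ τ) x ∈ V'.1.source := by
    simp only [Function.comp_apply, hτx]; exact h'.mapsTo x'.2
  -- Since `τ` covers the identity of `X`, both `φ` and `φ' ∘ τ` induce `f` near `x`.
  obtain ⟨D, hD, e⟩ := 𝒴.frameMap_eq_of_proj_eventuallyEq (V := V) (V' := V') (a := φ)
    (b := φ' ∘ τ) ((h.contDiffAt x.2).of_le hr)
    ((hφ'.of_le hr).comp _ (hτs.of_le (by simp))) (by
      filter_upwards [hτ.proj_eventuallyEq 𝒳, U.1.isOpen_source.mem_nhds x.2] with z h1 hz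
      refine ⟨h.mapsTo hz, h'.mapsTo h1.1, ?_⟩
      rw [h.proj_comp z hz, Function.comp_apply, h'.proj_comp _ h1.1, h1.2])
    (h.mapsTo x.2) hm hC
  refine ⟨D, ?_, e.trans ?_⟩
  · rw [hD, fderiv_comp _ (hφ'.differentiableAt (by positivity))
      (hτs.differentiableAt (by simp)), hB', hτx]
    rfl
  · congr 3
    simp [hτx]

/-- Let `φ` and `ψ` be lifts of mutually inverse maps. If `ψ` is defined at the image of a point
under `φ`, then the derivative of `φ` there is invertible, and `ψ` maps the images of frames
under `φ` back. -/
theorem isUnit_fderiv_and_frameMap_eq (hr : 1 ≤ r) (f : X ≃ Y) {U U' : 𝒳.atlas} {V V' : 𝒴.atlas}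
    {φ ψ : Eucl n → Eucl n} (h : IsLift r f U.1 V.1 φ) (h' : IsLift r f.symm V'.1 U'.1 ψ)
    (x : U.1.source) (hx : f (U.1.proj x) ∈ V'.1.image) :
    IsUnit (fderiv ℝ φ x) ∧ ∀ (B C C' : GLn n) (y : V'.1.source),
      (C : EndE n) = (fderiv ℝ φ x).comp (B : EndE n) →
      𝒴.frameMap V (⟨φ x, h.mapsTo x.2⟩, C) = 𝒴.frameMap V' (y, C') →
      ∃ D : GLn n, (D : EndE n) = (fderiv ℝ ψ y).comp (C' : EndE n) ∧
        𝒳.frameMap U (x, B) = 𝒳.frameMap U' (⟨ψ y, h'.mapsTo y.2⟩, D) := by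
  -- The frame `C` over `φ x` is arbitrary, because `fderiv ℝ φ x` is not yet known to be
  -- invertible; it only serves to produce a change of charts `τ` with differential `A`, which does
  -- not depend on `B`. The germ `ψ ∘ τ ∘ φ` induces the identity of `X` and is compared with `id`.
  have key : ∀ (C : GLn n) (c : V'.1.source × GLn n),
      𝒴.frameMap V (⟨φ x, h.mapsTo x.2⟩, C) = 𝒴.frameMap V' c →
      ∃ A : EndE n, (c.2 : EndE n) = A.comp (C : EndE n) ∧ ∀ B : GLn n, ∃ D : GLn n,
        (D : EndE n) = (fderiv ℝ ψ c.1).comp (A.comp ((fderiv ℝ φ x).comp (B : EndE n))) ∧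
        𝒳.frameMap U (x, B) = 𝒳.frameMap U' (⟨ψ c.1, h'.mapsTo c.1.2⟩, D) := by
    intro C c hc
    obtain ⟨τ, hτ⟩ := 𝒴.germ_of_eq (a := ⟨V, ⟨φ x, h.mapsTo x.2⟩, C⟩) (b := ⟨V', c⟩) hc
    have hτs : ContDiffAt ℝ ω τ (φ x) := hτ.1
    have hτx : τ (φ x) = c.1 := hτ.2.1
    have hφ := h.contDiffAt x.2
    have hψ : ContDiffAt ℝ r ψ (τ (φ x)) := h'.contDiffAt (by rw [hτx]; exact c.1.2)
    have hτφ : ContDiffAt ℝ 1 (τ ∘ φ) x := (hτs.of_le (by simp)).comp _ (hφ.of_le hr)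
    refine ⟨fderiv ℝ τ (φ x), hτ.2.2.1, fun B => ?_⟩
    have hm : (ψ ∘ τ ∘ φ) x ∈ U'.1.source := by
      simp only [Function.comp_apply, hτx]; exact h'.mapsTo c.1.2
    obtain ⟨D, hD, e⟩ := 𝒳.frameMap_eq_of_proj_eventuallyEq (V := U) (V' := U') (a := id)
      (b := ψ ∘ τ ∘ φ) (x := x) (B := (B : EndE n)) (C := B) contDiffAt_id
      (ContDiffAt.comp (f := τ ∘ φ) _ (hψ.of_le hr) hτφ) (by
        filter_upwards [hφ.continuousAt.eventually (hτ.proj_eventuallyEq 𝒴),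
          U.1.isOpen_source.mem_nhds x.2] with z h1 hz
        refine ⟨hz, h'.mapsTo h1.1, ?_⟩
        simp only [Function.comp_apply, id]
        rw [h'.proj_comp _ h1.1, h1.2, h.proj_comp z hz, f.symm_apply_apply])
      x.2 hm (by simp)
    refine ⟨D, ?_, e.trans ?_⟩
    · rw [hD, fderiv_comp (f := τ ∘ φ) _ (hψ.differentiableAt (by positivity))
        (hτφ.differentiableAt (by simp)), fderiv_comp _ (hτs.differentiableAt (by simp))
        (hφ.differentiableAt (by positivity)), Function.comp_apply, hτx]
      rfl
    · congr 3
      simp [hτx]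
  constructor
  · obtain ⟨c, hc⟩ := 𝒴.exists_frameMap_eq (U := V) (U' := V') (⟨φ x, h.mapsTo x.2⟩, 1)
      (by rw [h.proj_comp _ x.2]; exact hx)
    obtain ⟨A, -, hA⟩ := key 1 c hc
    obtain ⟨D, hD, -⟩ := hA 1
    -- With `B = 1` the frame `D` is `dψ ∘ A ∘ dφ`, so `D⁻¹ ∘ dψ ∘ A` is a left inverse of `dφ`.
    refine ContinuousLinearMap.isUnit_of_comp_eq_id
      (A := ((D⁻¹ : GLn n) : EndE n).comp ((fderiv ℝ ψ c.1).comp A)) ?_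
    have h1 : (D : EndE n) = ((fderiv ℝ ψ c.1).comp A).comp (fderiv ℝ φ x) := hD
    rw [ContinuousLinearMap.comp_assoc, ← h1]
    exact D.inv_mul
  · intro B C C' y hC hm
    obtain ⟨A, hA, hA'⟩ := key C (y, C') hm
    obtain ⟨D, hD, e⟩ := hA' B
    exact ⟨D, by rw [hD, hA, hC], e⟩

/-- The differential of a lift of an orbifold diffeomorphism is invertible. -/
theorem isUnit_fderiv_of_isLift (hr : 1 ≤ r) {f : X ≃ Y} (hf : IsOrbifoldDiffeo r 𝒳 𝒴 f)
    {U : 𝒳.atlas} {V : 𝒴.atlas} {φ : Eucl n → Eucl n} (h : IsLift r f U.1 V.1 φ)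
    (x : U.1.source) : IsUnit (fderiv ℝ φ x) := by
  obtain ⟨V', hV', hx, U', hU', -, ψ, hψ⟩ := hf.2 (f (U.1.proj x))
  exact (isUnit_fderiv_and_frameMap_eq (U' := ⟨U', hU'⟩) (V' := ⟨V', hV'⟩) hr f h hψ x hx).1

/-- Each frame is represented in a chart on which a given orbifold map has a lift. -/
theorem exists_frameMap_isLift {f : X → Y} (hf : IsOrbifoldMap r 𝒳 𝒴 f) (p : 𝒳.FrameBundle) :
    ∃ (U : 𝒳.atlas) (V : 𝒴.atlas) (φ : Eucl n → Eucl n) (_ : IsLift r f U.1 V.1 φ)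
      (a : U.1.source × GLn n), 𝒳.frameMap U a = p := by
  induction p using Quot.inductionOn with
  | h a =>
    obtain ⟨U, hU, hx, V, hV, -, φ, hφ⟩ := hf (a.1.1.proj a.2.1)
    obtain ⟨b, hb⟩ := 𝒳.exists_frameMap_eq (U := a.1) (U' := ⟨U, hU⟩) a.2 hx
    exact ⟨⟨U, hU⟩, ⟨V, hV⟩, φ, hφ, b, hb.symm⟩

/-- For each frame, choose a representative and a lift defined there and take the resulting image;
`frameMap_eq_of_isLift` shows that every other representative and lift gives the same point. -/
theorem exists_isInducedFrameMap (hr : 1 ≤ r) {f : X ≃ Y} (hf : IsOrbifoldDiffeo r 𝒳 𝒴 f) :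
    ∃ F, IsInducedFrameMap r 𝒳 𝒴 f F := by
  have hex : ∀ p : 𝒳.FrameBundle, ∃ q : 𝒴.FrameBundle,
      ∃ (U : 𝒳.atlas) (V : 𝒴.atlas) (φ : Eucl n → Eucl n) (h : IsLift r f U.1 V.1 φ)
        (a : U.1.source × GLn n) (C : GLn n), 𝒳.frameMap U a = p ∧
        (C : EndE n) = (fderiv ℝ φ a.1).comp (a.2 : EndE n) ∧
        q = 𝒴.frameMap V (⟨φ a.1, h.mapsTo a.1.2⟩, C) := by
    intro p
    obtain ⟨U, V, φ, h, a, ha⟩ := exists_frameMap_isLift hf.1 p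
    obtain ⟨u, hu⟩ := isUnit_fderiv_of_isLift hr hf h a.1
    exact ⟨_, U, V, φ, h, a, u * a.2, ha, by rw [← hu]; rfl, rfl⟩
  choose F hF using hex
  refine ⟨F, fun U V φ h x B => ?_⟩
  obtain ⟨U', V', φ', h', a, C, ha, hC, e⟩ := hF (𝒳.frameMap U (x, B))
  obtain ⟨D, hD, e'⟩ := frameMap_eq_of_isLift hr h' h ha hC
  exact ⟨D, hD, e.trans e'⟩

end ReducedAnalyticOrbifold

/-! ### Properties of the induced map -/

namespace IsInducedFrameMap

open ReducedAnalyticOrbifold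

variable {n : ℕ} {X Y : Type*} [TopologicalSpace X] [TopologicalSpace Y]
  {𝒳 : ReducedAnalyticOrbifold n X} {𝒴 : ReducedAnalyticOrbifold n Y} {r : WithTop ℕ∞}

theorem unique {f : X → Y} (hf : IsOrbifoldMap r 𝒳 𝒴 f) {F F' : 𝒳.FrameBundle → 𝒴.FrameBundle}
    (hF : IsInducedFrameMap r 𝒳 𝒴 f F) (hF' : IsInducedFrameMap r 𝒳 𝒴 f F') : F' = F := by
  funext p
  obtain ⟨U, V, φ, h, a, rfl⟩ := exists_frameMap_isLift hf p
  obtain ⟨C, hC, e⟩ := hF U V φ h a.1 a.2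
  obtain ⟨C', hC', e'⟩ := hF' U V φ h a.1 a.2
  obtain rfl : C = C' := Units.ext (hC.trans hC'.symm)
  exact e'.trans e.symm

/-- `F` composes with the differential of a lift on the left, while the group acts by composition on
the right. -/
theorem map_smul {f : X → Y} (hf : IsOrbifoldMap r 𝒳 𝒴 f) {F : 𝒳.FrameBundle → 𝒴.FrameBundle}
    (hF : IsInducedFrameMap r 𝒳 𝒴 f F) (A : GLn n) (p : 𝒳.FrameBundle) :
    F (MulOpposite.op A • p) = MulOpposite.op A • F p := by
  obtain ⟨U, V, φ, h, a, rfl⟩ := exists_frameMap_isLift hf p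
  obtain ⟨C, hC, e⟩ := hF U V φ h a.1 a.2
  obtain ⟨C', hC', e'⟩ := hF U V φ h a.1 (a.2 * A)
  obtain rfl : C' = C * A := Units.ext (by rw [hC', Units.val_mul, Units.val_mul, hC]; rfl)
  exact e'.trans (congrArg (MulOpposite.op A • ·) e).symm

theorem frameProj_apply {f : X → Y} (hf : IsOrbifoldMap r 𝒳 𝒴 f)
    {F : 𝒳.FrameBundle → 𝒴.FrameBundle} (hF : IsInducedFrameMap r 𝒳 𝒴 f F) (p : 𝒳.FrameBundle) :
    𝒴.frameProj (F p) = f (𝒳.frameProj p) := by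
  obtain ⟨U, V, φ, h, a, rfl⟩ := exists_frameMap_isLift hf p
  obtain ⟨C, hC, e⟩ := hF U V φ h a.1 a.2
  exact (congrArg 𝒴.frameProj e).trans (h.proj_comp _ a.1.2)

theorem leftInverse (hr : 1 ≤ r) {f : X ≃ Y} (hf : IsOrbifoldDiffeo r 𝒳 𝒴 f)
    {F : 𝒳.FrameBundle → 𝒴.FrameBundle} {F' : 𝒴.FrameBundle → 𝒳.FrameBundle}
    (hF : IsInducedFrameMap r 𝒳 𝒴 f F) (hF' : IsInducedFrameMap r 𝒴 𝒳 f.symm F') :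
    Function.LeftInverse F' F := by
  intro p
  obtain ⟨U, V, φ, h, a, rfl⟩ := exists_frameMap_isLift hf.1 p
  obtain ⟨C, hC, e⟩ := hF U V φ h a.1 a.2
  obtain ⟨V', U', ψ, h', b, hb⟩ := exists_frameMap_isLift hf.2 (F (𝒳.frameMap U a))
  obtain ⟨D, hD, e'⟩ := hF' V' U' ψ h' b.1 b.2
  -- The frame `b` represents `F` of the given frame, and `F` covers `f`, so `b.1` lies over this
  -- point.
  have hx : f (U.1.proj a.1) ∈ V'.1.image :=
    ⟨b.1, b.1.2, (congrArg 𝒴.frameProj hb).trans (hF.frameProj_apply hf.1 _)⟩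
  obtain ⟨D', hD', e''⟩ := (isUnit_fderiv_and_frameMap_eq hr f h h' a.1 hx).2 a.2 C b.2 b.1 hC
    (e.symm.trans hb.symm)
  obtain rfl : D = D' := Units.ext (hD.trans hD'.symm)
  rw [← hb]
  exact e'.trans e''.symm

/-- In the frame charts `c` and `d` the map is `T`, whose second component contains the derivative
of a `C^r` map; this accounts for the loss of one order of differentiability. -/
theorem contMDiff (hr : 1 ≤ r) {f : X → Y} (hf : IsOrbifoldMap r 𝒳 𝒴 f)
    {F : 𝒳.FrameBundle → 𝒴.FrameBundle} (hF : IsInducedFrameMap r 𝒳 𝒴 f F) :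
    ContMDiff 𝓘(ℝ, Eucl n × EndE n) 𝓘(ℝ, Eucl n × EndE n) (r - 1) F := by
  intro p
  obtain ⟨U, V, φ, h, a, rfl⟩ := exists_frameMap_isLift hf p
  obtain ⟨C, hC, e⟩ := hF U V φ h a.1 a.2
  obtain ⟨c, hc, hpc, hca, hc1, -⟩ := 𝒳.exists_frameAtlas_chart U a
  obtain ⟨d, hd, hqd, hda, -, hd1⟩ := 𝒴.exists_frameAtlas_chart V (⟨φ a.1, h.mapsTo a.1.2⟩, C)
  have hcm : c ∈ IsManifold.maximalAtlas 𝓘(ℝ, Eucl n × EndE n) (r - 1) 𝒳.FrameBundle :=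
    -- The frame charts are analytic, and `ω` is the top element of the smoothness exponents.
    IsManifold.maximalAtlas_subset_of_le le_top (IsManifold.subset_maximalAtlas hc)
  have hdm : d ∈ IsManifold.maximalAtlas 𝓘(ℝ, Eucl n × EndE n) (r - 1) 𝒴.FrameBundle :=
    IsManifold.maximalAtlas_subset_of_le le_top (IsManifold.subset_maximalAtlas hd)
  let T : Eucl n × EndE n → Eucl n × EndE n := fun q => (φ q.1, (fderiv ℝ φ q.1).comp q.2)
  have hr' : r - 1 + 1 ≤ r := (tsub_add_cancel_of_le hr).le
  have hT : ContDiffAt ℝ (r - 1) T (c (𝒳.frameMap U a)) := by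
    rw [hca]
    have h1 : ContDiffAt ℝ r φ (frameCoord U.1 a).1 := h.contDiffAt a.1.2
    have h2 : ContDiffAt ℝ (r - 1) (fderiv ℝ φ) (frameCoord U.1 a).1 := h1.fderiv_right hr'
    exact ((h1.of_le tsub_le_self).comp _ contDiffAt_fst).prodMk
      ((h2.comp _ contDiffAt_fst).clm_comp contDiffAt_snd)
  have hTa : T (c (𝒳.frameMap U a)) ∈ d.target := by
    have : T (c (𝒳.frameMap U a)) = frameCoord V.1 (⟨φ a.1, h.mapsTo a.1.2⟩, C) := by
      rw [hca]
      exact Prod.ext rfl hC.symm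
    rw [this, ← hda]
    exact d.map_source hqd
  have hTc := hT.contMDiffAt.comp (𝒳.frameMap U a) (contMDiffAt_of_mem_maximalAtlas hcm hpc)
  refine (ContMDiffAt.comp (f := T ∘ c) (𝒳.frameMap U a)
    (contMDiffAt_symm_of_mem_maximalAtlas hdm hTa) hTc).congr_of_eventuallyEq ?_
  filter_upwards [c.open_source.mem_nhds hpc] with p hp
  obtain ⟨b, rfl, hcb⟩ := hc1 p hp
  obtain ⟨D, hD, e'⟩ := hF U V φ h b.1 b.2
  have : T (c (𝒳.frameMap U b)) = frameCoord V.1 (⟨φ b.1, h.mapsTo b.1.2⟩, D) := by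
    rw [hcb]
    exact Prod.ext rfl hD.symm
  simp only [Function.comp_apply]
  -- As `hd1` holds for every frame, `c.source` need not be shrunk to make `T ∘ c` land in
  -- `d.target`.
  rw [this, hd1]
  exact e'

end IsInducedFrameMap

theorem lemma3p2 {n : ℕ} {X Y : Type*} [TopologicalSpace X] [TopologicalSpace Y]
    (𝒳 : ReducedAnalyticOrbifold n X) (𝒴 : ReducedAnalyticOrbifold n Y)
    (r : WithTop ℕ∞) (hr : 2 ≤ r) (f : X ≃ Y) (hf : IsOrbifoldDiffeo r 𝒳 𝒴 f) :
    ∃ F : Diffeomorph 𝓘(ℝ, Eucl n × EndE n) 𝓘(ℝ, Eucl n × EndE n)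
        𝒳.FrameBundle 𝒴.FrameBundle (r - 1),
      IsInducedFrameMap r 𝒳 𝒴 f F ∧
      (∀ F' : 𝒳.FrameBundle → 𝒴.FrameBundle, IsInducedFrameMap r 𝒳 𝒴 f F' → F' = F) ∧
      (∀ (A : GLn n) (p : 𝒳.FrameBundle), F (MulOpposite.op A • p) = MulOpposite.op A • F p) ∧
      ∀ p : 𝒳.FrameBundle, 𝒴.frameProj (F p) = f (𝒳.frameProj p) := by
  have hr1 : 1 ≤ r := one_le_two.trans hr
  have hf' : IsOrbifoldDiffeo r 𝒴 𝒳 f.symm := ⟨hf.2, hf.1⟩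
  obtain ⟨F, hF⟩ := ReducedAnalyticOrbifold.exists_isInducedFrameMap hr1 hf
  obtain ⟨F', hF'⟩ := ReducedAnalyticOrbifold.exists_isInducedFrameMap hr1 hf'
  exact ⟨⟨⟨F, F', hF.leftInverse hr1 hf hF', hF'.leftInverse hr1 hf' hF⟩,
    hF.contMDiff hr1 hf.1, hF'.contMDiff hr1 hf.2⟩, hF, fun _ h => hF.unique hf.1 h,
    hF.map_smul hf.1, hF.frameProj_apply hf.1⟩
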